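/- A 0-1 matrix $M$ contains a 0-1 matrix $P$ if some submatrix of $M$ (obtained by deleting rows and columns) either equals $P$ or can be turned into $P$ by changing some ones to zeroes; otherwise $M$ avoids $P$. Let $\mathrm{ex}(n,P)$ be the maximum number of ones in an $n \times n$ 0-1 matrix that avoids $P$ (taken to be $0$ if no such matrix exists). A 0-1 matrix $P$ is called minimally non-linear if $\mathrm{ex}(n,P) = \omega(n)$, but $\mathrm{ex}(n,P') = O(n)$ for every 0-1 matrix $P'$ that is contained in $P$ and not equal to $P$. Every minimally non-linear 0-1 matrix with $k$ rows has at most $4k-4$ columns. -/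

import Mathlib

namespace ZeroOneMatrix

/-- `Contains M P`: some submatrix of `M` (rows and columns kept in their order) equals `P` or
can be turned into `P` by changing some ones to zeroes. -/
def Contains {a b k l : ℕ} (M : Matrix (Fin a) (Fin b) (Fin 2))
    (P : Matrix (Fin k) (Fin l) (Fin 2)) : Prop :=
  ∃ (r : Fin k → Fin a) (c : Fin l → Fin b), StrictMono r ∧ StrictMono c ∧
    ∀ i j, P i j = 1 → M (r i) (c j) = 1

/-- `M` avoids `P` if it does not contain `P`. -/
def Avoids {a b k l : ℕ} (M : Matrix (Fin a) (Fin b) (Fin 2))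
    (P : Matrix (Fin k) (Fin l) (Fin 2)) : Prop :=
  ¬ Contains M P

/-- The number of ones of a 0-1 matrix. -/
def ones {a b : ℕ} (M : Matrix (Fin a) (Fin b) (Fin 2)) : ℕ :=
  (Finset.univ.filter fun p : Fin a × Fin b => M p.1 p.2 = 1).card

open Classical in
/-- The extremal function `ex(n, P)`: the maximum number of ones in an `n × n` 0-1 matrix that
avoids `P` (and `0` if no `n × n` matrix avoids `P`, which happens only when `P` has no ones). -/
noncomputable def ex {k l : ℕ} (n : ℕ) (P : Matrix (Fin k) (Fin l) (Fin 2)) : ℕ :=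
  (Finset.univ.filter fun M : Matrix (Fin n) (Fin n) (Fin 2) => Avoids M P).sup ones

/-- `P` is minimally non-linear: `ex(n, P) = ω(n)`, but `ex(n, P') = O(n)` for every 0-1 matrix
`P'` (of any dimensions) that is contained in `P` and is not equal to `P`. -/
def MinimallyNonLinear {k l : ℕ} (P : Matrix (Fin k) (Fin l) (Fin 2)) : Prop :=
  (fun n : ℕ => (n : ℝ)) =o[Filter.atTop] (fun n : ℕ => (ex n P : ℝ)) ∧
  ∀ (k' l' : ℕ) (P' : Matrix (Fin k') (Fin l') (Fin 2)), Contains P P' →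
    (⟨k', l', P'⟩ : Σ a b : ℕ, Matrix (Fin a) (Fin b) (Fin 2)) ≠ ⟨k, l, P⟩ →
    (fun n : ℕ => (ex n P' : ℝ)) =O[Filter.atTop] (fun n : ℕ => (n : ℝ))

end ZeroOneMatrix

/-! Call a pattern linear if `ex n P` is at most a constant times `n`. A minimally non-linear `P` is
not linear, but deleting any column makes it so; hence no column can be one whose reinsertion
preserves linearity. Such columns are: an empty column; a column with a single one whose two
neighbours both have a one in the same row; a first or last column with a single one whose neighbour
has a one in that row.

Choose a one in every column, changing rows from one column to the next whenever possible, and read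
the chosen rows as a word of length `l` over `k` letters. A repeated letter then signals a column
with a single one, so by the excluded columns runs have length at most two and the first and last
runs have length one. The word also has no subsequence `abab` with `a ≠ b`: the corresponding 2 × 4
alternating patterns are non-linear, so by minimality `P` would equal one of them, and 2 × 4 meets
the bound. Such a word has at most `2k - 2` changes of letter, and fewer repetitions than changes,
which gives `l ≤ 4k - 4`.

The non-linearity of the alternating pattern is the long part. Fan matrices avoid it, have at least
`k` ones in every row, and come with any fan size `m` and only slightly more than `k` columns per
fan. Once `m` exceeds `k` there are at least as many rows as columns, so the matrix can be padded to
a square one with at least `k` ones per row, for arbitrary `k`. They are built by a double recursion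
of Ackermann type: the fan size of one ingredient is the number of fans of the other. -/

namespace ZeroOneMatrix

/-! ### Words without alternation -/

/-- A sequence with `k` letters without alternating subsequences of length four, whose runs have
length at most two and whose first and last runs have length one, has length at most `4k - 4`. -/
theorem length_le_of_no_alternation {k : ℕ} (hk : 2 ≤ k) (l : ℕ) (s : ℕ → Fin k)
    (h4 : ∀ a b c d, a < b → b < c → c < d → d < l → s a = s c → s b = s d → s a = s b)
    (h3 : ∀ i, i + 2 < l → s i = s (i + 1) → s (i + 1) ≠ s (i + 2))
    (h0 : 1 < l → s 0 ≠ s 1) (hl : ∀ i, i + 2 = l → s i ≠ s (i + 1)) :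
    l ≤ 4 * k - 4 := by
  classical
  by_cases hl2 : l ≤ 1
  · omega
  push Not at hl2
  set T := (Finset.range (l - 1)).filter fun i => s i ≠ s (i + 1) with hT
  set E := (Finset.range (l - 1)).filter fun i => ¬ s i ≠ s (i + 1) with hE
  have hTE : T.card + E.card = l - 1 := by
    rw [hT, hE, Finset.card_filter_add_card_filter_not, Finset.card_range]
  have h0T : 0 ∈ T := by
    simp only [hT, Finset.mem_filter, Finset.mem_range]
    exact ⟨by omega, h0 hl2⟩
  -- A repetition at `i` is followed by a change at `i + 1`. The change at `0` is never reached by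
  -- this shift, which saves one.
  have hET : E.card ≤ T.card - 1 := by
    rw [← Finset.card_erase_of_mem h0T]
    refine Finset.card_le_card_of_injOn (· + 1) ?_ (fun a _ b _ h => by simpa using h)
    intro i hi
    simp only [hE, not_not, Finset.coe_filter, Finset.mem_range, Set.mem_ofPred_eq] at hi
    have hi2 : i + 2 ≠ l := fun h => hl i h hi.2
    simp only [hT, Finset.coe_erase, Finset.coe_filter, Finset.mem_range, Set.mem_sdiff,
      Set.mem_ofPred_eq, Set.mem_singleton_iff]
    exact ⟨⟨by omega, h3 i (by omega) hi.2⟩, by omega⟩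
  set A := (Finset.range (l - 1)).filter fun i => ∀ q, i < q → q < l → s q ≠ s i with hA
  set B := (Finset.range (l - 1)).filter fun i => ∀ p, p ≤ i → s p ≠ s (i + 1) with hB
  -- At a change, the left letter occurs for the last time or the right letter for the first time;
  -- otherwise an earlier copy of the right letter and a later copy of the left one complete an
  -- alternation.
  have hTAB : T ⊆ A ∪ B := by
    intro i hi
    simp only [hT, Finset.mem_filter, Finset.mem_range] at hi
    simp only [hA, hB, Finset.mem_union, Finset.mem_filter, Finset.mem_range]
    by_contra hcon
    have h1 : ∃ q, i < q ∧ q < l ∧ s q = s i := by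
      by_contra hq; push Not at hq; exact hcon (Or.inl ⟨hi.1, hq⟩)
    have h2 : ∃ p, p ≤ i ∧ s p = s (i + 1) := by
      by_contra hq; push Not at hq; exact hcon (Or.inr ⟨hi.1, hq⟩)
    obtain ⟨q, hq1, hq2, hq3⟩ := h1
    obtain ⟨p, hp1, hp2⟩ := h2
    have hpi : p ≠ i := by rintro rfl; exact hi.2 hp2
    have hqi : q ≠ i + 1 := by rintro rfl; exact hi.2 hq3.symm
    have := h4 p i (i + 1) q (by omega) (by omega) (by omega) hq2 hp2 hq3.symm
    exact hi.2 (this ▸ hp2)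
  -- Last occurrences carry distinct letters, and the final letter of the word is not among them.
  -- The bound on `B` is the mirror image.
  have hAk : A.card ≤ k - 1 := by
    have : (Finset.univ.erase (s (l - 1))).card = k - 1 := by
      rw [Finset.card_erase_of_mem (Finset.mem_univ _), Finset.card_univ, Fintype.card_fin]
    rw [← this]
    refine Finset.card_le_card_of_injOn s ?_ ?_
    · intro i hi
      simp only [hA, Finset.coe_filter, Finset.mem_range, Set.mem_ofPred_eq] at hi
      simp only [Finset.coe_erase, Finset.coe_univ, Set.mem_sdiff, Set.mem_univ,
        Set.mem_singleton_iff, true_and]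
      exact (hi.2 (l - 1) hi.1 (by omega)).symm
    · intro i hi j hj hij
      simp only [hA, Finset.coe_filter, Finset.mem_range, Set.mem_ofPred_eq] at hi hj
      rcases lt_trichotomy i j with h | h | h
      · exact absurd hij.symm (hi.2 j h (by omega))
      · exact h
      · exact absurd hij (hj.2 i h (by omega))
  have hBk : B.card ≤ k - 1 := by
    have : (Finset.univ.erase (s 0)).card = k - 1 := by
      rw [Finset.card_erase_of_mem (Finset.mem_univ _), Finset.card_univ, Fintype.card_fin]
    rw [← this]
    refine Finset.card_le_card_of_injOn (fun i => s (i + 1)) ?_ ?_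
    · intro i hi
      simp only [hB, Finset.coe_filter, Finset.mem_range, Set.mem_ofPred_eq] at hi
      simp only [Finset.coe_erase, Finset.coe_univ, Set.mem_sdiff, Set.mem_univ,
        Set.mem_singleton_iff, true_and]
      exact (hi.2 0 (by omega)).symm
    · intro i hi j hj hij
      simp only [hB, Finset.coe_filter, Finset.mem_range, Set.mem_ofPred_eq] at hi hj
      simp only at hij
      rcases lt_trichotomy i j with h | h | h
      · exact absurd hij (hj.2 (i + 1) (by omega))
      · exact h
      · exact absurd hij.symm (hi.2 (j + 1) (by omega))
  have hTc : T.card ≤ A.card + B.card :=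
    (Finset.card_le_card hTAB).trans (Finset.card_union_le _ _)
  have hTpos : 0 < T.card := Finset.card_pos.2 ⟨0, h0T⟩
  omega

/-! ### Extremal function and linearity -/

theorem ones_le_ex {k l n : ℕ} {P : Matrix (Fin k) (Fin l) (Fin 2)}
    {M : Matrix (Fin n) (Fin n) (Fin 2)} (h : Avoids M P) : ones M ≤ ex n P := by
  classical
  exact Finset.le_sup (f := ones) (Finset.mem_filter.2 ⟨Finset.mem_univ M, h⟩)

theorem ex_le {k l n B : ℕ} {P : Matrix (Fin k) (Fin l) (Fin 2)}
    (h : ∀ M : Matrix (Fin n) (Fin n) (Fin 2), Avoids M P → ones M ≤ B) : ex n P ≤ B := by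
  classical
  exact Finset.sup_le fun M hM => h M (Finset.mem_filter.1 hM).2

theorem ones_le {a b : ℕ} (M : Matrix (Fin a) (Fin b) (Fin 2)) : ones M ≤ a * b := by
  refine (Finset.card_le_univ _).trans ?_
  simp

theorem ones_eq_sum {a b : ℕ} (M : Matrix (Fin a) (Fin b) (Fin 2)) :
    ones M = ∑ i, (Finset.univ.filter fun j => M i j = 1).card := by
  unfold ones
  rw [Finset.card_eq_sum_card_fiberwise (f := Prod.fst) (t := Finset.univ) (by simp [Set.MapsTo])]
  refine Finset.sum_congr rfl fun i _ => ?_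
  refine Finset.card_bij' (fun p _ => p.2) (fun j _ => (i, j)) ?_ ?_ ?_ ?_
  · rintro ⟨i', j⟩ hp
    simp only [Finset.mem_filter, Finset.mem_univ, true_and] at hp ⊢
    rw [← hp.2]; exact hp.1
  · intro j hj
    simpa using hj
  · rintro ⟨i', j⟩ hp
    simp only [Finset.mem_filter, Finset.mem_univ, true_and] at hp
    rw [← hp.2]
  · intro j _
    rfl

theorem ex_le_mul_self {k l : ℕ} (n : ℕ) (P : Matrix (Fin k) (Fin l) (Fin 2)) :
    ex n P ≤ n * n :=
  ex_le fun M _ => ones_le M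

/-- The extremal function of `P` is at most linear. -/
def IsLinear {k l : ℕ} (P : Matrix (Fin k) (Fin l) (Fin 2)) : Prop :=
  ∃ C : ℕ, ∀ n : ℕ, ex n P ≤ C * n

theorem isLinear_iff_isBigO {k l : ℕ} {P : Matrix (Fin k) (Fin l) (Fin 2)} :
    IsLinear P ↔
      (fun n : ℕ => (ex n P : ℝ)) =O[Filter.atTop] (fun n : ℕ => (n : ℝ)) := by
  constructor
  · rintro ⟨C, hC⟩
    refine Asymptotics.IsBigO.of_bound C (Filter.Eventually.of_forall fun n => ?_)
    simp only [Real.norm_natCast]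
    exact_mod_cast hC n
  · intro h
    obtain ⟨c, hc⟩ := h.bound
    obtain ⟨N, hN⟩ := Filter.eventually_atTop.1 hc
    -- Below the threshold `N`, the trivial bound `n * n ≤ N * n` makes the estimate uniform in `n`.
    refine ⟨max N ⌈c⌉₊, fun n => ?_⟩
    rcases le_total N n with hn | hn
    · have h1 := hN n hn
      simp only [Real.norm_natCast] at h1
      have h2 : (ex n P : ℝ) ≤ (⌈c⌉₊ * n : ℕ) := by
        push_cast
        exact h1.trans (mul_le_mul_of_nonneg_right (Nat.le_ceil c) (Nat.cast_nonneg n))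
      exact (Nat.cast_le.1 h2).trans (Nat.mul_le_mul_right n (le_max_right _ _))
    · exact (ex_le_mul_self n P).trans
        (Nat.mul_le_mul_right n (hn.trans (le_max_left _ _)))

theorem MinimallyNonLinear.not_isLinear {k l : ℕ} {P : Matrix (Fin k) (Fin l) (Fin 2)}
    (hP : MinimallyNonLinear P) : ¬ IsLinear P := by
  intro h
  have h1 := hP.1.trans_isBigO (isLinear_iff_isBigO.1 h)
  refine Asymptotics.isLittleO_irrefl ?_ h1
  refine (Filter.eventually_atTop.2 ⟨1, fun n hn => ?_⟩).frequently
  simp only [ne_eq, Nat.cast_eq_zero]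
  omega

/-! ### Column insertions that preserve linearity -/

/-- `P` with its column `j` deleted. -/
def eraseCol {k l : ℕ} (P : Matrix (Fin k) (Fin (l + 1)) (Fin 2)) (j : Fin (l + 1)) :
    Matrix (Fin k) (Fin l) (Fin 2) :=
  P.submatrix id j.succAbove

theorem MinimallyNonLinear.isLinear_eraseCol {k l : ℕ}
    {P : Matrix (Fin k) (Fin (l + 1)) (Fin 2)} (hP : MinimallyNonLinear P) (j : Fin (l + 1)) :
    IsLinear (eraseCol P j) := by
  refine isLinear_iff_isBigO.2 (hP.2 _ _ _ ⟨id, j.succAbove, strictMono_id,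
    Fin.strictMono_succAbove j, fun _ _ h => h⟩ ?_)
  intro h
  have := congrArg (fun x => x.2.1) h
  simp at this

/-- An occurrence of `P` without its column `j` extends to an occurrence of `P` by a column in
the right position. -/
theorem contains_of_insert {a b k l : ℕ} {M : Matrix (Fin a) (Fin b) (Fin 2)}
    {P : Matrix (Fin k) (Fin (l + 1)) (Fin 2)} {j : Fin (l + 1)} {r : Fin k → Fin a}
    {c : Fin l → Fin b} (hr : StrictMono r) (hc : StrictMono c)
    (hM : ∀ i i', eraseCol P j i i' = 1 → M (r i) (c i') = 1) (x : Fin b)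
    (hlt : ∀ i : Fin l, (i : ℕ) < j → c i < x) (hgt : ∀ i : Fin l, (j : ℕ) ≤ i → x < c i)
    (hx : ∀ i, P i j = 1 → M (r i) x = 1) : Contains M P := by
  refine ⟨r, j.insertNth x c, hr, ?_, ?_⟩
  · intro u v huv
    induction u using Fin.succAboveCases j with
    | x =>
      induction v using Fin.succAboveCases j with
      | x => exact absurd huv (lt_irrefl _)
      | p v =>
        rw [Fin.insertNth_apply_same, Fin.insertNth_apply_succAbove]
        refine hgt v ?_
        by_contra h
        push Not at h
        rw [Fin.succAbove_of_castSucc_lt _ _ (by rwa [Fin.lt_def, Fin.val_castSucc])] at huv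
        rw [Fin.lt_def, Fin.val_castSucc] at huv
        omega
    | p u =>
      induction v using Fin.succAboveCases j with
      | x =>
        rw [Fin.insertNth_apply_same, Fin.insertNth_apply_succAbove]
        refine hlt u ?_
        by_contra h
        push Not at h
        rw [Fin.succAbove_of_le_castSucc _ _ (by rwa [Fin.le_def, Fin.val_castSucc])] at huv
        rw [Fin.lt_def, Fin.val_succ] at huv
        omega
      | p v =>
        rw [Fin.insertNth_apply_succAbove, Fin.insertNth_apply_succAbove]
        exact hc ((Fin.strictMono_succAbove j).lt_iff_lt.1 huv)
  · intro i v h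
    induction v using Fin.succAboveCases j with
    | x => rw [Fin.insertNth_apply_same]; exact hx i h
    | p v => rw [Fin.insertNth_apply_succAbove]; exact hM i v h

/-- The matrix whose ones are the ones of `M` satisfying `p`. -/
def keep {a b : ℕ} (M : Matrix (Fin a) (Fin b) (Fin 2)) (p : Fin a → Fin b → Prop)
    [∀ i j, Decidable (p i j)] : Matrix (Fin a) (Fin b) (Fin 2) :=
  fun i j => if M i j = 1 ∧ p i j then 1 else 0

theorem keep_eq_one {a b : ℕ} {M : Matrix (Fin a) (Fin b) (Fin 2)} {p : Fin a → Fin b → Prop}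
    [∀ i j, Decidable (p i j)] {i : Fin a} {j : Fin b} :
    keep M p i j = 1 ↔ M i j = 1 ∧ p i j := by
  unfold keep
  split_ifs with h <;> simp [h]

theorem ones_keep_add {a b : ℕ} (M : Matrix (Fin a) (Fin b) (Fin 2)) (p : Fin a → Fin b → Prop)
    [∀ i j, Decidable (p i j)] :
    ones (keep M p) + ones (keep M fun i j => ¬ p i j) = ones M := by
  unfold ones
  simp only [keep_eq_one, ← Finset.filter_filter]
  exact Finset.card_filter_add_card_filter_not _

/-- A column with a single one can be inserted between two columns with a one in the same row. -/
theorem isLinear_of_between {k l : ℕ} {P : Matrix (Fin k) (Fin (l + 1)) (Fin 2)}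
    {j : Fin (l + 1)} {a : Fin k} (hj : ∀ i, P i j = 1 → i = a) {u v : Fin l}
    (hu : (u : ℕ) + 1 = j) (hv : (v : ℕ) = j) (hPu : eraseCol P j a u = 1)
    (hPv : eraseCol P j a v = 1) (h : IsLinear (eraseCol P j)) : IsLinear P := by
  classical
  obtain ⟨C, hC⟩ := h
  refine ⟨2 * C, fun n => ex_le fun M hM => ?_⟩
  -- `N i j` is the rank of position `j` among the ones of row `i`. Two ones of a row with ranks of
  -- equal parity are not consecutive, so another one lies between them; each parity class therefore
  -- avoids the smaller pattern.
  set N : Fin n → Fin n → ℕ := fun i j =>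
    (Finset.univ.filter fun j' : Fin n => M i j' = 1 ∧ j' < j).card with hN
  have key : ∀ (p : Fin n → Fin n → Prop) [∀ i j, Decidable (p i j)],
      (∀ i x y, p i x → p i y → N i y ≠ N i x + 1) → ones (keep M p) ≤ ex n (eraseCol P j) := by
    intro p _ hp
    refine ones_le_ex fun ⟨r, c, hr, hc, hrc⟩ => hM ?_
    have huv : u < v := by rw [Fin.lt_def]; omega
    obtain ⟨hu1, hu2⟩ := keep_eq_one.1 (hrc a u hPu)
    obtain ⟨hv1, hv2⟩ := keep_eq_one.1 (hrc a v hPv)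
    obtain ⟨x, hx1, hx2, hx3⟩ : ∃ x, M (r a) x = 1 ∧ c u < x ∧ x < c v := by
      by_contra hcon
      push Not at hcon
      refine hp _ _ _ hu2 hv2 ?_
      have : (Finset.univ.filter fun j' : Fin n => M (r a) j' = 1 ∧ j' < c v)
          = insert (c u) (Finset.univ.filter fun j' : Fin n => M (r a) j' = 1 ∧ j' < c u) := by
        ext y
        simp only [Finset.mem_filter, Finset.mem_univ, true_and, Finset.mem_insert]
        constructor
        · rintro ⟨hy1, hy2⟩
          rcases lt_trichotomy y (c u) with h | h | h
          · exact Or.inr ⟨hy1, h⟩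
          · exact Or.inl h
          · exact absurd hy2 (not_lt.2 (hcon y hy1 h))
        · rintro (rfl | ⟨hy1, hy2⟩)
          · exact ⟨hu1, hc huv⟩
          · exact ⟨hy1, hy2.trans (hc huv)⟩
      simp only [hN]
      rw [this, Finset.card_insert_of_notMem (by simp)]
    refine contains_of_insert hr hc (fun i i' h => (keep_eq_one.1 (hrc i i' h)).1) x ?_ ?_ ?_
    · intro i hi
      exact lt_of_le_of_lt (hc.monotone (by rw [Fin.le_def]; omega)) hx2
    · intro i hi
      exact lt_of_lt_of_le hx3 (hc.monotone (by rw [Fin.le_def]; omega))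
    · intro i hi
      rw [hj i hi]; exact hx1
  have h1 := key (fun i j => Even (N i j)) (by
    intro i x y hx hy h
    rw [h] at hy
    exact (Nat.even_add_one.1 hy) hx)
  have h2 := key (fun i j => ¬ Even (N i j)) (by
    intro i x y hx hy h
    rw [h] at hy
    exact hy (Nat.even_add_one.2 hx))
  have h3 := ones_keep_add M fun i j => Even (N i j)
  have h4 := hC n
  nlinarith

/-- If thinning out each row of `M` by at most one entry can destroy all occurrences of the
pattern with column `j` deleted, then linearity is inherited. -/
theorem isLinear_of_delete_one {k l : ℕ} {P : Matrix (Fin k) (Fin l) (Fin 2)} {k' l' : ℕ}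
    {P' : Matrix (Fin k') (Fin l') (Fin 2)}
    (p : ∀ n, Matrix (Fin n) (Fin n) (Fin 2) → Fin n → Fin n → Prop)
    (hp : ∀ n M i x y, M i x = 1 → M i y = 1 → ¬ p n M i x → ¬ p n M i y → x = y)
    (hM : ∀ (n : ℕ) (M : Matrix (Fin n) (Fin n) (Fin 2)) (r : Fin k' → Fin n)
      (c : Fin l' → Fin n), StrictMono r → StrictMono c →
      (∀ i j, P' i j = 1 → M (r i) (c j) = 1 ∧ p n M (r i) (c j)) → Contains M P)
    (h : IsLinear P') : IsLinear P := by
  classical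
  obtain ⟨C, hC⟩ := h
  refine ⟨C + 1, fun n => ex_le fun M hMP => ?_⟩
  have h1 : ones (keep M (p n M)) ≤ ex n P' :=
    ones_le_ex fun ⟨r, c, hr, hc, hrc⟩ =>
      hMP (hM n M r c hr hc fun i j hij => keep_eq_one.1 (hrc i j hij))
  have h2 : ones (keep M fun i j => ¬ p n M i j) ≤ n := by
    have : (Finset.univ : Finset (Fin n)).card = n := by simp
    conv_rhs => rw [← this]
    refine Finset.card_le_card_of_injOn (fun q => q.1) (by simp [Set.MapsTo]) ?_
    rintro ⟨i, x⟩ hx ⟨i', y⟩ hy (rfl : i = i')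
    simp only [Finset.coe_filter, Finset.mem_univ, true_and, Set.mem_ofPred_eq, keep_eq_one]
      at hx hy
    rw [hp n M i x y hx.1 hy.1 hx.2 hy.2]
  have h3 := ones_keep_add M (p n M)
  have h4 := hC n
  nlinarith

/-- A last column with a single one can be attached next to a one. -/
theorem isLinear_of_last {k l : ℕ} {P : Matrix (Fin k) (Fin (l + 1)) (Fin 2)} {a : Fin k}
    (hj : ∀ i, P i (Fin.last l) = 1 → i = a) {u : Fin l} (hu : (u : ℕ) + 1 = l)
    (hPu : eraseCol P (Fin.last l) a u = 1) (h : IsLinear (eraseCol P (Fin.last l))) :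
    IsLinear P := by
  refine isLinear_of_delete_one (fun n M i x => ∃ y, x < y ∧ M i y = 1) ?_ ?_ h
  · intro n M i x y hx hy hpx hpy
    by_contra hne
    rcases lt_or_gt_of_ne hne with h | h
    · exact hpx ⟨y, h, hy⟩
    · exact hpy ⟨x, h, hx⟩
  · intro n M r c hr hc hM
    obtain ⟨x, hx1, hx2⟩ := (hM a u hPu).2
    refine contains_of_insert hr hc (fun i i' h => (hM i i' h).1) x ?_ ?_ ?_
    · intro i hi
      exact lt_of_le_of_lt (hc.monotone (by rw [Fin.le_def]; omega)) hx1
    · intro i hi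
      rw [Fin.val_last] at hi; omega
    · intro i hi
      rw [hj i hi]; exact hx2

/-- A first column with a single one can be attached next to a one. -/
theorem isLinear_of_first {k l : ℕ} {P : Matrix (Fin k) (Fin (l + 1)) (Fin 2)} {a : Fin k}
    (hj : ∀ i, P i 0 = 1 → i = a) {u : Fin l} (hu : (u : ℕ) = 0)
    (hPu : eraseCol P 0 a u = 1) (h : IsLinear (eraseCol P 0)) :
    IsLinear P := by
  refine isLinear_of_delete_one (fun n M i x => ∃ y, y < x ∧ M i y = 1) ?_ ?_ h
  · intro n M i x y hx hy hpx hpy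
    by_contra hne
    rcases lt_or_gt_of_ne hne with h | h
    · exact hpy ⟨x, h, hx⟩
    · exact hpx ⟨y, h, hy⟩
  · intro n M r c hr hc hM
    obtain ⟨x, hx1, hx2⟩ := (hM a u hPu).2
    refine contains_of_insert hr hc (fun i i' h => (hM i i' h).1) x ?_ ?_ ?_
    · intro i hi
      simp at hi
    · intro i hi
      exact lt_of_lt_of_le hx1 (hc.monotone (by rw [Fin.le_def]; omega))
    · intro i hi
      rw [hj i hi]; exact hx2

/-- An empty column can be inserted anywhere. -/
theorem isLinear_of_empty {k l : ℕ} {P : Matrix (Fin k) (Fin (l + 1)) (Fin 2)}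
    {j : Fin (l + 1)} (hj : ∀ i, P i j ≠ 1) (h : IsLinear (eraseCol P j)) : IsLinear P := by
  classical
  obtain ⟨C, hC⟩ := h
  refine ⟨4 * C + 8, fun n => ex_le fun M hM => ?_⟩
  rcases Nat.eq_zero_or_pos n with rfl | hn0
  · exact (ones_le M).trans (by simp)
  -- The ones are split by the parities of row and column, each class being compressed to an `m × m`
  -- matrix. Columns are spread out to leave a free column in every gap; the offset `t ≥ 1` and the
  -- `- 2` also leave one at each end. Rows are thinned only because `ex` concerns square matrices.
  set m := (n - 2) / 2 with hm
  have key : ∀ s t : ℕ, s ≤ 1 → 1 ≤ t → t ≤ 2 →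
      (Finset.univ.filter fun p : Fin n × Fin n =>
        M p.1 p.2 = 1 ∧ ∃ i < m, ∃ j < m, (p.1 : ℕ) = 2 * i + s ∧ (p.2 : ℕ) = 2 * j + t).card
        ≤ ex m (eraseCol P j) := by
    intro s t hs ht1 ht2
    have hrow : ∀ i : Fin m, 2 * (i : ℕ) + s < n := fun i => by have := i.2; omega
    have hcol : ∀ i : Fin m, 2 * (i : ℕ) + t < n := fun i => by have := i.2; omega
    set M' : Matrix (Fin m) (Fin m) (Fin 2) :=
      fun x y => M ⟨2 * x + s, hrow x⟩ ⟨2 * y + t, hcol y⟩ with hM'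
    have hle : ones M' ≤ ex m (eraseCol P j) := by
      refine ones_le_ex fun ⟨r, c, hr, hc, hrc⟩ => hM ?_
      have hx : ∃ x : ℕ, x < n ∧ (∀ i : Fin l, (i : ℕ) < j → 2 * (c i : ℕ) + t < x) ∧
          ∀ i : Fin l, (j : ℕ) ≤ i → x < 2 * (c i : ℕ) + t := by
        by_cases hj0 : (j : ℕ) = 0
        · exact ⟨0, hn0, fun i hi => by omega, fun i hi => by omega⟩
        · have hjl : (j : ℕ) - 1 < l := by have := j.2; omega
          refine ⟨2 * (c ⟨j - 1, hjl⟩ : ℕ) + t + 1, ?_, ?_, ?_⟩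
          · have := (c ⟨j - 1, hjl⟩).2; omega
          · intro i hi
            have : c i ≤ c ⟨j - 1, hjl⟩ := hc.monotone (by rw [Fin.le_def]; simp only; omega)
            rw [Fin.le_def] at this
            omega
          · intro i hi
            have : c ⟨j - 1, hjl⟩ < c i := hc (by rw [Fin.lt_def]; simp only; omega)
            rw [Fin.lt_def] at this
            omega
      obtain ⟨x, hxn, hx1, hx2⟩ := hx
      refine contains_of_insert (j := j) (r := fun i => ⟨2 * r i + s, hrow _⟩)
        (c := fun i => ⟨2 * c i + t, hcol _⟩) ?_ ?_ hrc ⟨x, hxn⟩ ?_ ?_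
        (fun i hi => absurd hi (hj i))
      · intro u v huv
        have := hr huv
        rw [Fin.lt_def] at this ⊢
        simp only; omega
      · intro u v huv
        have := hc huv
        rw [Fin.lt_def] at this ⊢
        simp only; omega
      · intro i hi; exact hx1 i hi
      · intro i hi; exact hx2 i hi
    refine le_trans ?_ hle
    refine le_trans (Finset.card_le_card (t := (Finset.univ.filter
      fun p : Fin m × Fin m => M' p.1 p.2 = 1).image
      fun p => (⟨2 * p.1 + s, hrow _⟩, ⟨2 * p.2 + t, hcol _⟩)) ?_) Finset.card_image_le
    rintro ⟨p, q⟩ hpq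
    simp only [Finset.mem_filter, Finset.mem_univ, true_and] at hpq
    obtain ⟨h1, x, hx, y, hy, hp, hq⟩ := hpq
    simp only [Finset.mem_image, Finset.mem_filter, Finset.mem_univ, true_and, Prod.exists,
      Prod.mk.injEq]
    have e1 : (⟨2 * x + s, hrow ⟨x, hx⟩⟩ : Fin n) = p := Fin.ext hp.symm
    have e2 : (⟨2 * y + t, hcol ⟨y, hy⟩⟩ : Fin n) = q := Fin.ext hq.symm
    refine ⟨⟨x, hx⟩, ⟨y, hy⟩, ?_, e1, e2⟩
    simp only [hM']
    rw [e1, e2]; exact h1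
  set G : ℕ → ℕ → Finset (Fin n × Fin n) := fun s t => Finset.univ.filter fun p =>
    M p.1 p.2 = 1 ∧ ∃ i < m, ∃ j < m, (p.1 : ℕ) = 2 * i + s ∧ (p.2 : ℕ) = 2 * j + t with hG
  set R := Finset.univ.filter fun x : Fin n => 2 * m ≤ x with hR
  set Q := Finset.univ.filter fun x : Fin n => (x : ℕ) = 0 ∨ 2 * m < x with hQ
  -- At most three rows and three columns escape the four classes, costing at most `6 * n` ones.
  have hRc : R.card ≤ 3 := by
    refine le_trans (Finset.card_le_card_of_injOn (t := Finset.Ico (2 * m) n) Fin.val ?_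
      Fin.val_injective.injOn) ?_
    · intro x hx
      simp only [hR, Finset.coe_filter, Finset.mem_univ, true_and, Set.mem_ofPred_eq] at hx
      simp [hx]
    · rw [Nat.card_Ico]; omega
  have hQc : Q.card ≤ 3 := by
    refine le_trans (Finset.card_le_card_of_injOn (t := insert 0 (Finset.Ico (2 * m + 1) n))
      Fin.val ?_ Fin.val_injective.injOn) ?_
    · intro x hx
      simp only [hQ, Finset.coe_filter, Finset.mem_univ, true_and, Set.mem_ofPred_eq] at hx
      simp only [Finset.coe_insert, Finset.coe_Ico, Set.mem_insert_iff, Set.mem_Ico]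
      omega
    · refine (Finset.card_insert_le _ _).trans ?_
      rw [Nat.card_Ico]; omega
  have hsub : (Finset.univ.filter fun p : Fin n × Fin n => M p.1 p.2 = 1) ⊆
      (((G 0 1 ∪ G 0 2) ∪ (G 1 1 ∪ G 1 2)) ∪ (R ×ˢ Finset.univ ∪ Finset.univ ×ˢ Q)) := by
    rintro ⟨x, y⟩ hxy
    simp only [Finset.mem_filter, Finset.mem_univ, true_and] at hxy
    simp only [hG, hR, hQ, Finset.mem_union, Finset.mem_product, Finset.mem_filter,
      Finset.mem_univ, true_and, and_true, hxy]
    by_cases h1 : 2 * m ≤ x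
    · exact Or.inr (Or.inl h1)
    by_cases h2 : (y : ℕ) = 0 ∨ 2 * m < y
    · exact Or.inr (Or.inr h2)
    refine Or.inl ?_
    rcases Nat.mod_two_eq_zero_or_one x with hx | hx <;>
      rcases Nat.mod_two_eq_zero_or_one y with hy | hy
    · exact Or.inl (Or.inr ⟨x / 2, by omega, y / 2 - 1, by omega, by omega, by omega⟩)
    · exact Or.inl (Or.inl ⟨x / 2, by omega, y / 2, by omega, by omega, by omega⟩)
    · exact Or.inr (Or.inr ⟨x / 2, by omega, y / 2 - 1, by omega, by omega, by omega⟩)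
    · exact Or.inr (Or.inl ⟨x / 2, by omega, y / 2, by omega, by omega, by omega⟩)
  have hcard := Finset.card_le_card hsub
  have u1 := Finset.card_union_le ((G 0 1 ∪ G 0 2) ∪ (G 1 1 ∪ G 1 2))
    (R ×ˢ Finset.univ ∪ Finset.univ ×ˢ Q)
  have u2 := Finset.card_union_le (G 0 1 ∪ G 0 2) (G 1 1 ∪ G 1 2)
  have u3 := Finset.card_union_le (G 0 1) (G 0 2)
  have u4 := Finset.card_union_le (G 1 1) (G 1 2)
  have u5 := Finset.card_union_le (R ×ˢ (Finset.univ : Finset (Fin n)))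
    ((Finset.univ : Finset (Fin n)) ×ˢ Q)
  rw [Finset.card_product, Finset.card_product, Finset.card_univ, Fintype.card_fin] at u5
  have k1 := key 0 1 (by omega) (by omega) (by omega)
  have k2 := key 0 2 (by omega) (by omega) (by omega)
  have k3 := key 1 1 (by omega) (by omega) (by omega)
  have k4 := key 1 2 (by omega) (by omega) (by omega)
  have hCm : C * m ≤ C * n := Nat.mul_le_mul_left C (by omega)
  have hR3 : R.card * n ≤ 3 * n := Nat.mul_le_mul_right n hRc
  have hQ3 : n * Q.card ≤ n * 3 := Nat.mul_le_mul_left n hQc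
  have := hC m
  have e : (4 * C + 8) * n = 4 * (C * n) + 8 * n := by ring
  rw [e]
  change (Finset.univ.filter fun p : Fin n × Fin n => M p.1 p.2 = 1).card ≤ _
  simp only [hG] at hcard u1 u2 u3 u4
  omega

/-! ### Fan matrices and their recursive step -/

/-- An incidence relation between ordered rows and columns without the alternating pattern with
two rows and four columns. Every row has at least `k` ones. The rows are partitioned into fans of
size `m`; all rows of a fan have their first one in the fan's own column, and after this column
the ones of lower rows of the fan precede those of higher rows. -/
structure IsFanMatrix {Φ R K : Type} [LinearOrder Φ] [LinearOrder R] [LinearOrder K] (k m : ℕ)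
    (E : R → K → Prop) (fan : Φ → K) (row : Φ → Fin m → R) : Prop where
  fan_strictMono : StrictMono fan
  row_strictMono : ∀ φ, StrictMono (row φ)
  row_surj : ∀ r, ∃ φ i, row φ i = r
  mem_fan : ∀ φ i ψ, E (row φ i) (fan ψ) ↔ φ = ψ
  fan_le : ∀ φ i c, E (row φ i) c → fan φ ≤ c
  rest_lt : ∀ φ i j c d, i < j → E (row φ i) c → E (row φ j) d → c ≠ fan φ → d ≠ fan φ → d < c
  avoid : ∀ r r' c₁ c₂ c₃ c₄, r < r' → c₁ < c₂ → c₂ < c₃ → c₃ < c₄ →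
    E r c₁ → E r' c₂ → E r c₃ → ¬ E r' c₄
  le_card_row : ∀ r, k ≤ {c | E r c}.ncard

theorem IsFanMatrix.row_inj {Φ R K : Type} [LinearOrder Φ] [LinearOrder R] [LinearOrder K]
    {k m : ℕ} {E : R → K → Prop} {fan : Φ → K} {row : Φ → Fin m → R}
    (h : IsFanMatrix k m E fan row) {φ ψ : Φ} {i j : Fin m} (hij : row φ i = row ψ j) :
    φ = ψ ∧ i = j := by
  have h1 : φ = ψ := by
    refine (h.mem_fan φ i ψ).1 ?_
    rw [hij]
    exact (h.mem_fan ψ j ψ).2 rfl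
  subst h1
  exact ⟨rfl, (h.row_strictMono φ).injective hij⟩

section Step

set_option linter.unusedSectionVars false

variable {Φc Rc Kc Φb Rb Kb : Type} [LinearOrder Φc] [LinearOrder Rc] [LinearOrder Kc]
  [LinearOrder Φb] [LinearOrder Rb] [LinearOrder Kb] {k m F : ℕ}
  (Ec : Rc → Kc → Prop) (fc : Φc → Kc) (rc : Φc → Fin F → Rc)
  (Eb : Rb → Kb → Prop) (fb : Φb → Kb) (rb : Φb → Fin m → Rb) (e : Φb → Fin F)

/-- In front of each fan column of `Ec` a copy of `Eb` is inserted, on new rows below those of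
`Ec`, and each row of the fan receives a new one in a fan column of the copy. -/
def stepRel (r : Rc ⊕ₗ (Φc ×ₗ Rb)) (q : Kc ×ₗ WithTop Kb) : Prop :=
  Sum.elim
    (fun a => ((ofLex q).2 = ⊤ ∧ Ec a (ofLex q).1) ∨
      ∃ g φ, a = rc g (e φ) ∧ (ofLex q).1 = fc g ∧ (ofLex q).2 = fb φ)
    (fun p => (ofLex q).1 = fc (ofLex p).1 ∧ ∃ y : Kb, (ofLex q).2 = y ∧ Eb (ofLex p).2 y)
    (ofLex r)

/-- The fan columns of the fan columns of the copies. -/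
def stepFan (p : Φc ×ₗ Φb) : Kc ×ₗ WithTop Kb :=
  toLex (fc (ofLex p).1, (fb (ofLex p).2 : WithTop Kb))

/-- The rows of the enlarged fans. -/
def stepRow (p : Φc ×ₗ Φb) : Fin (m + 1) → Rc ⊕ₗ (Φc ×ₗ Rb) :=
  Fin.cons (Sum.inlₗ (rc (ofLex p).1 (e (ofLex p).2)))
    fun i => Sum.inrₗ (toLex ((ofLex p).1, rb (ofLex p).2 i))

variable {Ec fc rc Eb fb rb e}

theorem stepRel_inl {a : Rc} {c : Kc} {x : WithTop Kb} :
    stepRel Ec fc rc Eb fb e (Sum.inlₗ a) (toLex (c, x)) ↔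
      (x = ⊤ ∧ Ec a c) ∨ ∃ g φ, a = rc g (e φ) ∧ c = fc g ∧ x = fb φ :=
  Iff.rfl

theorem stepRel_inr {g : Φc} {b : Rb} {c : Kc} {x : WithTop Kb} :
    stepRel Ec fc rc Eb fb e (Sum.inrₗ (toLex (g, b))) (toLex (c, x)) ↔
      c = fc g ∧ ∃ y : Kb, x = y ∧ Eb b y :=
  Iff.rfl

/-- An alternation must lie within old rows, within one copy of `Eb`, or use an old row above a new
one. The last is impossible since an old row has at most one one in each copy and none before it
when it has one there. Two old rows of different fans reduce to `Ec`; for two of the same fan, the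
reversed order `e` of the new ones prevents an alternation from starting before the fan column. -/
theorem stepRel_avoid (hC : IsFanMatrix k F Ec fc rc) (hB : IsFanMatrix (k + 1) m Eb fb rb)
    (he : StrictAnti e) (hes : Function.Surjective e)
    (r r' : Rc ⊕ₗ (Φc ×ₗ Rb)) (c₁ c₂ c₃ c₄ : Kc ×ₗ WithTop Kb) (hr : r < r') (h12 : c₁ < c₂)
    (h23 : c₂ < c₃) (h34 : c₃ < c₄) (h1 : stepRel Ec fc rc Eb fb e r c₁)
    (h2 : stepRel Ec fc rc Eb fb e r' c₂) (h3 : stepRel Ec fc rc Eb fb e r c₃) :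
    ¬ stepRel Ec fc rc Eb fb e r' c₄ := by
  intro h4
  obtain ⟨⟨c₁, x₁⟩, rfl⟩ := toLex.surjective c₁
  obtain ⟨⟨c₂, x₂⟩, rfl⟩ := toLex.surjective c₂
  obtain ⟨⟨c₃, x₃⟩, rfl⟩ := toLex.surjective c₃
  obtain ⟨⟨c₄, x₄⟩, rfl⟩ := toLex.surjective c₄
  rw [Prod.Lex.toLex_lt_toLex] at h12 h23 h34
  simp only at h12 h23 h34
  obtain ⟨r, rfl⟩ := toLex.surjective r
  obtain ⟨r', rfl⟩ := toLex.surjective r'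
  rcases r with a | p
  · rcases r' with b | p'
    · replace h1 := stepRel_inl.1 h1
      replace h2 := stepRel_inl.1 h2
      replace h3 := stepRel_inl.1 h3
      replace h4 := stepRel_inl.1 h4
      have hab : a < b := Sum.Lex.inl_lt_inl_iff.1 hr
      obtain ⟨g, i, rfl⟩ := hC.row_surj a
      obtain ⟨h, j, rfl⟩ := hC.row_surj b
      by_cases hgh : g = h
      · subst hgh
        have hij : i < j := (hC.row_strictMono g).lt_iff_lt.1 hab
        obtain ⟨φ, rfl⟩ := hes i
        obtain ⟨ψ, rfl⟩ := hes j
        have hlt : fb ψ < fb φ := hB.fan_strictMono (he.lt_iff_gt.1 hij)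
        -- Within fan `g`, each row consists of its new one followed by old ones from column `fc g`
        -- on.
        have key : ∀ {χ : Φb} {c : Kc} {x : WithTop Kb},
            ((x = ⊤ ∧ Ec (rc g (e χ)) c) ∨
              ∃ g' χ', rc g (e χ) = rc g' (e χ') ∧ c = fc g' ∧ x = fb χ') →
            (x = ⊤ ∧ Ec (rc g (e χ)) c ∧ fc g ≤ c) ∨ (c = fc g ∧ x = fb χ) := by
          rintro χ c x (⟨h, h'⟩ | ⟨g', χ', h, h', h''⟩)
          · exact Or.inl ⟨h, h', hC.fan_le _ _ _ h'⟩
          · obtain ⟨rfl, hχ⟩ := hC.row_inj h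
            rw [he.injective hχ]
            exact Or.inr ⟨h', h''⟩
        have hlt' : (fb ψ : WithTop Kb) < fb φ := WithTop.coe_lt_coe.2 hlt
        rcases key h3 with ⟨rfl, h3, h3'⟩ | ⟨rfl, rfl⟩
        · rcases key h4 with ⟨rfl, h4, h4'⟩ | ⟨rfl, rfl⟩
          · rcases h34 with h34 | ⟨-, h34⟩
            · by_cases hc3 : c₃ = fc g
              · subst hc3
                rcases key h2 with ⟨rfl, h2, h2'⟩ | ⟨rfl, rfl⟩
                · rcases h23 with h | ⟨-, h⟩
                  · exact absurd h (not_lt.2 h2')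
                  · exact absurd h (lt_irrefl _)
                · rcases key h1 with ⟨rfl, h1, h1'⟩ | ⟨rfl, rfl⟩
                  · rcases h12 with h | ⟨-, h⟩
                    · exact absurd h (not_lt.2 h1')
                    · exact absurd h not_top_lt
                  · rcases h12 with h | ⟨-, h⟩
                    · exact absurd h (lt_irrefl _)
                    · exact absurd h (not_lt.2 hlt'.le)
              · exact absurd (hC.rest_lt g _ _ _ _ hij h3 h4 hc3
                  (lt_of_le_of_lt h3' h34).ne') (not_lt.2 h34.le)
            · exact absurd h34 (lt_irrefl _)
          · rcases h34 with h | ⟨-, h⟩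
            · exact absurd h (not_lt.2 h3')
            · exact absurd h not_top_lt
        · have h13 : c₁ < fc g ∨ c₁ = fc g ∧ x₁ < fb φ := by
            rcases h12 with h | ⟨h, h'⟩ <;> rcases h23 with k | ⟨k, k'⟩
            · exact Or.inl (h.trans k)
            · exact Or.inl (h.trans_eq k)
            · exact Or.inl (h.trans_lt k)
            · exact Or.inr ⟨h.trans k, h'.trans k'⟩
          rcases key h1 with ⟨rfl, h1, h1'⟩ | ⟨rfl, rfl⟩
          · rcases h13 with h | ⟨-, h⟩
            · exact absurd h (not_lt.2 h1')
            · exact absurd h not_top_lt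
          · rcases h13 with h | ⟨-, h⟩ <;> exact absurd h (lt_irrefl _)
      · have key : ∀ {g : Φc} {i : Fin F} {c : Kc} {x : WithTop Kb},
            ((x = ⊤ ∧ Ec (rc g i) c) ∨
              ∃ g' χ', rc g i = rc g' (e χ') ∧ c = fc g' ∧ x = fb χ') →
            Ec (rc g i) c ∧ (x = ⊤ ∨ c = fc g) := by
          rintro g i c x (⟨h, h'⟩ | ⟨g', χ', h, h', h''⟩)
          · exact ⟨h', Or.inl h⟩
          · obtain ⟨rfl, hχ⟩ := hC.row_inj h
            rw [h']
            exact ⟨(hC.mem_fan _ _ _).2 rfl, Or.inr rfl⟩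
        -- Forgetting the second coordinate keeps the order strict: if two ones shared a column of
        -- `Ec`, the earlier would be a new one in front of its fan column, and the other row would
        -- belong to that fan.
        have strict : ∀ {g h : Φc} {i j : Fin F} {c d : Kc} {x y : WithTop Kb}, g ≠ h →
            (c < d ∨ c = d ∧ x < y) → Ec (rc g i) c ∧ (x = ⊤ ∨ c = fc g) →
            Ec (rc h j) d ∧ (y = ⊤ ∨ d = fc h) → c < d := by
          rintro g h i j c d x y hgh (hcd | ⟨rfl, hxy⟩) ⟨hc, hc'⟩ ⟨hd, hd'⟩
          · exact hcd
          · rcases hc' with rfl | rfl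
            · exact absurd hxy not_top_lt
            · exact absurd ((hC.mem_fan _ _ _).1 hd).symm hgh
        have k1 := key h1
        have k2 := key h2
        have k3 := key h3
        have k4 := key h4
        exact hC.avoid _ _ _ _ _ _ hab (strict hgh h12 k1 k2) (strict (Ne.symm hgh) h23 k2 k3)
          (strict hgh h34 k3 k4) k1.1 k2.1 k3.1 k4.1
    · obtain ⟨⟨g, b⟩, rfl⟩ := toLex.surjective p'
      replace h1 := stepRel_inl.1 h1
      replace h2 := stepRel_inr.1 h2
      replace h3 := stepRel_inl.1 h3
      replace h4 := stepRel_inr.1 h4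
      obtain ⟨rfl, y₂, rfl, -⟩ := h2
      obtain ⟨rfl, y₄, rfl, -⟩ := h4
      have hc3 : c₃ = fc g := by
        refine le_antisymm ?_ ?_
        · rcases h34 with h | ⟨h, -⟩
          · exact h.le
          · exact h.le
        · rcases h23 with h | ⟨h, -⟩
          · exact h.le
          · exact h.le
      subst hc3
      rcases h3 with ⟨rfl, h3⟩ | ⟨g', φ, rfl, hg, rfl⟩
      · rcases h34 with h | ⟨-, h⟩
        · exact absurd h (lt_irrefl _)
        · exact absurd h not_top_lt
      · obtain rfl := hC.fan_strictMono.injective hg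
        rcases h1 with ⟨rfl, h1⟩ | ⟨g', φ', h1, rfl, rfl⟩
        · rcases h12 with h | ⟨-, h⟩
          · exact absurd h (not_lt.2 (hC.fan_le _ _ _ h1))
          · exact absurd h not_top_lt
        · obtain ⟨rfl, h⟩ := hC.row_inj h1
          obtain rfl := he.injective h
          rcases h12 with h | ⟨-, h⟩
          · exact absurd h (lt_irrefl _)
          · rcases h23 with h' | ⟨-, h'⟩
            · exact absurd h' (lt_irrefl _)
            · exact absurd h' (not_lt.2 h.le)
  · rcases r' with b | p'
    · exact absurd hr Sum.Lex.not_inr_lt_inl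
    · obtain ⟨⟨g, a⟩, rfl⟩ := toLex.surjective p
      obtain ⟨⟨h, b⟩, rfl⟩ := toLex.surjective p'
      obtain ⟨rfl, y₁, rfl, h1'⟩ := stepRel_inr.1 h1
      obtain ⟨rfl, y₂, rfl, h2'⟩ := stepRel_inr.1 h2
      obtain ⟨hc₃, y₃, rfl, h3'⟩ := stepRel_inr.1 h3
      obtain ⟨hc₄, y₄, rfl, h4'⟩ := stepRel_inr.1 h4
      have hgh : g = h := by
        refine hC.fan_strictMono.injective (le_antisymm ?_ ?_)
        · rcases h12 with h | ⟨h, -⟩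
          · exact h.le
          · exact h.le
        · rw [← hc₃]
          rcases h23 with h | ⟨h, -⟩
          · exact h.le
          · exact h.le
      subst hgh hc₃ hc₄
      simp only [lt_irrefl, true_and, false_or, WithTop.coe_lt_coe] at h12 h23 h34
      have hab : a < b := by
        have := Sum.Lex.inr_lt_inr_iff.1 hr
        simpa [Prod.Lex.toLex_lt_toLex] using this
      exact hB.avoid _ _ _ _ _ _ hab h12 h23 h34 h1' h2' h3' h4'

/-- Old rows gain the one that raises `k` to `k + 1`; rows of the copies already have enough. An old
row joins a fan of a copy as its first row: its other ones lie to the right of the whole copy, as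
`rest_lt` demands. -/
theorem isFanMatrix_step [Finite Kc] [Finite Kb] (hC : IsFanMatrix k F Ec fc rc)
    (hB : IsFanMatrix (k + 1) m Eb fb rb) (he : StrictAnti e) (hes : Function.Surjective e) :
    IsFanMatrix (k + 1) (m + 1) (stepRel Ec fc rc Eb fb e) (stepFan fc fb)
      (stepRow rc rb e) where
  fan_strictMono := by
    intro p q hpq
    rw [Prod.Lex.lt_iff] at hpq
    rw [stepFan, stepFan, Prod.Lex.toLex_lt_toLex]
    rcases hpq with h | ⟨h, h'⟩
    · exact Or.inl (hC.fan_strictMono h)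
    · exact Or.inr ⟨congrArg fc h, WithTop.coe_lt_coe.2 (hB.fan_strictMono h')⟩
  row_strictMono := by
    intro p i j hij
    induction j using Fin.cases with
    | zero => exact absurd hij (Fin.not_lt_zero i)
    | succ j =>
      induction i using Fin.cases with
      | zero =>
        rw [stepRow, Fin.cons_zero, Fin.cons_succ]
        exact Sum.Lex.inl_lt_inr _ _
      | succ i =>
        rw [stepRow, Fin.cons_succ, Fin.cons_succ]
        refine Sum.Lex.inr_lt_inr_iff.2 (Prod.Lex.toLex_lt_toLex.2 (Or.inr ⟨rfl, ?_⟩))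
        exact hB.row_strictMono _ (Fin.succ_lt_succ_iff.1 hij)
  row_surj := by
    intro r
    obtain ⟨r, rfl⟩ := toLex.surjective r
    rcases r with a | p
    · obtain ⟨g, i, rfl⟩ := hC.row_surj a
      obtain ⟨φ, rfl⟩ := hes i
      exact ⟨toLex (g, φ), 0, rfl⟩
    · obtain ⟨⟨g, b⟩, rfl⟩ := toLex.surjective p
      obtain ⟨φ, i, rfl⟩ := hB.row_surj b
      exact ⟨toLex (g, φ), i.succ, rfl⟩
  mem_fan := by
    intro p i q
    obtain ⟨⟨g, φ⟩, rfl⟩ := toLex.surjective p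
    obtain ⟨⟨h, ψ⟩, rfl⟩ := toLex.surjective q
    rw [toLex.injective.eq_iff, Prod.mk.injEq]
    induction i using Fin.cases with
    | zero =>
      refine stepRel_inl.trans ⟨?_, ?_⟩
      · rintro (⟨h, -⟩ | ⟨g', φ', h1, h2, h3⟩)
        · exact absurd h (WithTop.coe_ne_top)
        · obtain ⟨rfl, h4⟩ := hC.row_inj h1
          exact ⟨(hC.fan_strictMono.injective h2).symm, (he.injective h4).trans
            (hB.fan_strictMono.injective (WithTop.coe_injective h3)).symm⟩
      · rintro ⟨rfl, rfl⟩
        exact Or.inr ⟨g, φ, rfl, rfl, rfl⟩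
    | succ i =>
      refine stepRel_inr.trans ⟨?_, ?_⟩
      · rintro ⟨h1, y, h2, h3⟩
        obtain rfl := WithTop.coe_injective h2
        exact ⟨(hC.fan_strictMono.injective h1).symm, (hB.mem_fan _ _ _).1 h3⟩
      · rintro ⟨rfl, rfl⟩
        exact ⟨rfl, fb φ, rfl, (hB.mem_fan _ _ _).2 rfl⟩
  fan_le := by
    intro p i q
    obtain ⟨⟨g, φ⟩, rfl⟩ := toLex.surjective p
    obtain ⟨⟨c, x⟩, rfl⟩ := toLex.surjective q
    intro h
    refine Prod.Lex.toLex_le_toLex.2 ?_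
    simp only
    induction i using Fin.cases with
    | zero =>
      rcases stepRel_inl.1 h with ⟨rfl, h'⟩ | ⟨g', φ', h1, rfl, rfl⟩
      · rcases (hC.fan_le _ _ _ h').lt_or_eq with h | h
        · exact Or.inl h
        · exact Or.inr ⟨h, le_top⟩
      · obtain ⟨rfl, h4⟩ := hC.row_inj h1
        obtain rfl := he.injective h4
        exact Or.inr ⟨rfl, le_rfl⟩
    | succ i =>
      obtain ⟨rfl, y, rfl, h3⟩ := stepRel_inr.1 h
      exact Or.inr ⟨rfl, WithTop.coe_le_coe.2 (hB.fan_le _ _ _ h3)⟩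
  rest_lt := by
    intro p i j q q' hij
    obtain ⟨⟨g, φ⟩, rfl⟩ := toLex.surjective p
    obtain ⟨⟨c, x⟩, rfl⟩ := toLex.surjective q
    obtain ⟨⟨d, y⟩, rfl⟩ := toLex.surjective q'
    intro h1 h2 hc hd
    refine Prod.Lex.toLex_lt_toLex.2 ?_
    simp only
    induction j using Fin.cases with
    | zero => exact absurd hij (Fin.not_lt_zero i)
    | succ j =>
      obtain ⟨rfl, y, rfl, h2'⟩ := stepRel_inr.1 h2
      induction i using Fin.cases with
      | zero =>
        rcases stepRel_inl.1 h1 with ⟨rfl, h⟩ | ⟨g', φ', h1', rfl, rfl⟩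
        · rcases (hC.fan_le _ _ _ h).lt_or_eq with h | h
          · exact Or.inl h
          · exact Or.inr ⟨h, WithTop.coe_lt_top y⟩
        · obtain ⟨rfl, h4⟩ := hC.row_inj h1'
          obtain rfl := he.injective h4
          exact absurd rfl hc
      | succ i =>
        obtain ⟨rfl, x, rfl, h1'⟩ := stepRel_inr.1 h1
        refine Or.inr ⟨rfl, WithTop.coe_lt_coe.2 ?_⟩
        refine hB.rest_lt φ i j x y (Fin.succ_lt_succ_iff.1 hij) h1' h2' ?_ ?_
        · rintro rfl; exact hc rfl
        · rintro rfl; exact hd rfl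
  avoid := stepRel_avoid hC hB he hes
  le_card_row := by
    have : Finite (Kc ×ₗ WithTop Kb) := inferInstanceAs (Finite (Kc × WithTop Kb))
    intro r
    obtain ⟨r, rfl⟩ := toLex.surjective r
    rcases r with a | p
    · obtain ⟨g, i, rfl⟩ := hC.row_surj a
      obtain ⟨φ, rfl⟩ := hes i
      set A : Set (Kc ×ₗ WithTop Kb) :=
        (fun c => toLex (c, (⊤ : WithTop Kb))) '' {c | Ec (rc g (e φ)) c} with hA
      have hinj : Function.Injective fun c : Kc => toLex (c, (⊤ : WithTop Kb)) :=
        fun c d h => (Prod.mk.inj (toLex.injective h)).1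
      have hnot : toLex (fc g, (fb φ : WithTop Kb)) ∉ A := by
        rintro ⟨c, -, h⟩
        exact WithTop.coe_ne_top (Prod.mk.inj (toLex.injective h)).2.symm
      have h1 := Set.ncard_insert_of_notMem hnot (Set.toFinite A)
      rw [hA, Set.ncard_image_of_injective _ hinj, ← hA] at h1
      refine (Nat.succ_le_succ (hC.le_card_row (rc g (e φ)))).trans (h1.symm.le.trans ?_)
      refine Set.ncard_le_ncard ?_ (Set.toFinite _)
      rintro q (rfl | ⟨c, hc, rfl⟩)
      · exact Or.inr ⟨g, φ, rfl, rfl, rfl⟩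
      · exact Or.inl ⟨rfl, hc⟩
    · obtain ⟨⟨g, b⟩, rfl⟩ := toLex.surjective p
      have hinj : Function.Injective fun y : Kb => toLex (fc g, (y : WithTop Kb)) :=
        fun c d h => WithTop.coe_injective (Prod.mk.inj (toLex.injective h)).2
      refine (hB.le_card_row b).trans ?_
      rw [← Set.ncard_image_of_injective _ hinj]
      refine Set.ncard_le_ncard ?_ (Set.toFinite _)
      rintro q ⟨y, hy, rfl⟩
      exact ⟨rfl, y, rfl, hy⟩

/-- Only nonempty columns are counted, because `Kc ×ₗ WithTop Kb` provides room for a copy in front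
of every column of `Ec`, while only fan columns receive one. New ones of old rows lie in columns
already used by the copies. -/
theorem ncard_support_stepRel_le [Finite Φc] [Finite Kc] [Finite Kb]
    (hB : IsFanMatrix (k + 1) m Eb fb rb) (hm : 0 < m) :
    {q | ∃ r, stepRel Ec fc rc Eb fb e r q}.ncard ≤
      {c | ∃ r, Ec r c}.ncard + Nat.card Φc * {c | ∃ r, Eb r c}.ncard := by
  have : Finite (Kc ×ₗ WithTop Kb) := inferInstanceAs (Finite (Kc × WithTop Kb))
  have hsub : {q | ∃ r, stepRel Ec fc rc Eb fb e r q} ⊆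
      (fun c => toLex (c, (⊤ : WithTop Kb))) '' {c | ∃ r, Ec r c} ∪
        (fun p : Φc × Kb => toLex (fc p.1, (p.2 : WithTop Kb))) ''
          (Set.univ ×ˢ {c | ∃ r, Eb r c}) := by
    rintro q ⟨r, h⟩
    obtain ⟨⟨c, x⟩, rfl⟩ := toLex.surjective q
    obtain ⟨r, rfl⟩ := toLex.surjective r
    rcases r with a | p
    · rcases stepRel_inl.1 h with ⟨rfl, h'⟩ | ⟨g, φ, -, rfl, rfl⟩
      · exact Or.inl ⟨c, ⟨a, h'⟩, rfl⟩
      · exact Or.inr ⟨(g, fb φ), ⟨trivial, rb φ ⟨0, hm⟩, (hB.mem_fan _ _ _).2 rfl⟩, rfl⟩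
    · obtain ⟨⟨g, b⟩, rfl⟩ := toLex.surjective p
      obtain ⟨rfl, y, rfl, h'⟩ := stepRel_inr.1 h
      exact Or.inr ⟨(g, y), ⟨trivial, b, h'⟩, rfl⟩
  refine (Set.ncard_le_ncard hsub (Set.toFinite _)).trans ((Set.ncard_union_le _ _).trans ?_)
  refine add_le_add (Set.ncard_image_le (Set.toFinite _)) ?_
  refine (Set.ncard_image_le (Set.toFinite _)).trans ?_
  rw [Set.ncard_prod, Set.ncard_univ]

end Step

/-! ### Existence of fan matrices with few columns -/

/-- There is a fan matrix with parameters `k`, `m`, with `F` fans and at most `N` columns. -/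
def ExistsFanMatrix (k m F N : ℕ) : Prop :=
  ∃ (Φ R K : Type) (_ : LinearOrder Φ) (_ : LinearOrder R) (_ : LinearOrder K) (_ : Finite Φ)
    (_ : Finite K) (E : R → K → Prop) (fan : Φ → K) (row : Φ → Fin m → R),
    IsFanMatrix k m E fan row ∧ Nat.card Φ = F ∧ {c | ∃ r, E r c}.ncard ≤ N

theorem ExistsFanMatrix.step {k m F F' N N' : ℕ} (hC : ExistsFanMatrix k F F' N')
    (hB : ExistsFanMatrix (k + 1) m F N) (hm : 0 < m) :
    ExistsFanMatrix (k + 1) (m + 1) (F' * F) (N' + F' * N) := by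
  obtain ⟨Φc, Rc, Kc, _, _, _, _, _, Ec, fc, rc, hC, hF', hN'⟩ := hC
  obtain ⟨Φb, Rb, Kb, _, _, _, _, _, Eb, fb, rb, hB, hF, hN⟩ := hB
  have := Fintype.ofFinite Φb
  set o : Fin F ≃o Φb := Fintype.orderIsoFinOfCardEq Φb (by rw [← hF, Nat.card_eq_fintype_card])
  -- The reversal puts the new ones of later rows of a fan further to the left.
  set e : Φb → Fin F := fun φ => Fin.rev (o.symm φ) with he
  have he1 : StrictAnti e := fun φ ψ h => Fin.rev_lt_rev.2 (o.symm.strictMono h)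
  have he2 : Function.Surjective e := Fin.rev_surjective.comp o.symm.surjective
  refine ⟨Φc ×ₗ Φb, Rc ⊕ₗ (Φc ×ₗ Rb), Kc ×ₗ WithTop Kb, inferInstance, inferInstance,
    inferInstance, inferInstanceAs (Finite (Φc × Φb)), inferInstanceAs (Finite (Kc × WithTop Kb)),
    stepRel Ec fc rc Eb fb e, stepFan fc fb, stepRow rc rb e,
    isFanMatrix_step hC hB he1 he2, ?_, ?_⟩
  · rw [← hF, ← hF', ← Nat.card_prod]
    rfl
  · refine (ncard_support_stepRel_le hB hm).trans ?_
    rw [hF']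
    exact add_le_add hN' (Nat.mul_le_mul_left _ hN)

theorem existsFanMatrix_one (m t : ℕ) : ExistsFanMatrix 1 m t t := by
  refine ⟨Fin t, Fin t ×ₗ Fin m, Fin t, inferInstance, inferInstance, inferInstance,
    inferInstance, inferInstance, fun r c => (ofLex r).1 = c, id, fun φ i => toLex (φ, i),
    ⟨strictMono_id, ?_, ?_, ?_, ?_, ?_, ?_, ?_⟩, by simp, ?_⟩
  · intro φ i j hij
    exact Prod.Lex.toLex_lt_toLex.2 (Or.inr ⟨rfl, hij⟩)
  · intro r
    exact ⟨(ofLex r).1, (ofLex r).2, rfl⟩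
  · intro φ i ψ
    rfl
  · rintro φ i c rfl
    exact le_rfl
  · rintro φ i j c d - rfl - h
    exact absurd rfl h
  · rintro r r' c₁ c₂ c₃ c₄ - h h' - h1 h2 h3
    exact absurd (h1.symm.trans h3) (h.trans h').ne
  · intro r
    simp
  · refine (Set.ncard_le_ncard (Set.subset_univ _) Set.finite_univ).trans ?_
    rw [Set.ncard_univ, Nat.card_eq_fintype_card, Fintype.card_fin]

theorem existsFanMatrix_size_one (k t : ℕ) : ExistsFanMatrix (k + 1) 1 t (t * (k + 1)) := by
  have hfin : Finite (Fin t ×ₗ Fin (k + 1)) := inferInstanceAs (Finite (Fin t × Fin (k + 1)))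
  refine ⟨Fin t, Fin t, Fin t ×ₗ Fin (k + 1), inferInstance, inferInstance, inferInstance,
    inferInstance, hfin, fun r c => (ofLex c).1 = r, fun φ => toLex (φ, 0), fun φ _ => φ,
    ⟨?_, ?_, ?_, ?_, ?_, ?_, ?_, ?_⟩, by simp, ?_⟩
  · intro φ ψ h
    exact Prod.Lex.toLex_lt_toLex.2 (Or.inl h)
  · intro φ i j hij
    exact absurd hij (by simp [Subsingleton.elim i j])
  · intro r
    exact ⟨r, 0, rfl⟩
  · intro φ i ψ
    exact eq_comm
  · rintro φ i c rfl
    exact Prod.Lex.le_iff.2 (Or.inr ⟨rfl, Fin.zero_le _⟩)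
  · intro φ i j c d hij
    exact absurd hij (by simp [Subsingleton.elim i j])
  · rintro r r' c₁ c₂ c₃ c₄ hr h12 h23 - h1 h2 h3 -
    subst h1 h2
    rcases Prod.Lex.lt_iff.1 h23 with h | ⟨h, -⟩
    · rw [h3] at h
      exact absurd h (not_lt.2 hr.le)
    · rw [h3] at h
      exact absurd h hr.ne'
  · intro r
    have hinj : Function.Injective fun i : Fin (k + 1) => toLex (r, i) :=
      fun i j h => (Prod.mk.inj (toLex.injective h)).2
    have h := Set.ncard_image_of_injective (Set.univ : Set (Fin (k + 1))) hinj
    rw [Set.ncard_univ, Nat.card_eq_fintype_card, Fintype.card_fin] at h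
    refine h.ge.trans (Set.ncard_le_ncard ?_ (Set.toFinite _))
    rintro q ⟨i, -, rfl⟩
    rfl
  · refine (Set.ncard_le_ncard (Set.subset_univ _) Set.finite_univ).trans ?_
    rw [Set.ncard_univ]
    change Nat.card (Fin t × Fin (k + 1)) ≤ _
    rw [Nat.card_prod, Nat.card_eq_fintype_card, Nat.card_eq_fintype_card, Fintype.card_fin,
      Fintype.card_fin]

/-- The number of columns per fan can be brought arbitrarily close to `k`, for any fan size. -/
theorem exists_existsFanMatrix (k : ℕ) : ∀ m p : ℕ, 0 < p → ∃ F N, p ≤ F ∧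
    ExistsFanMatrix (k + 1) (m + 1) F N ∧ p * N ≤ (p * (k + 1) + 1) * F := by
  induction k with
  | zero =>
    intro m p _
    exact ⟨p, p, le_rfl, existsFanMatrix_one _ _, Nat.mul_le_mul_right p (by omega)⟩
  | succ k ihk =>
    intro m
    induction m with
    | zero =>
      intro p _
      refine ⟨p, p * (k + 1 + 1), le_rfl, existsFanMatrix_size_one _ _, ?_⟩
      nlinarith
    | succ m ihm =>
      intro p hp
      -- The new ratio of columns to fans is `N / F + N' / (F' * F)`. Here `N / F` exceeds `k + 2`
      -- by at most `1 / (2p(k + 2))`, and `N' ≤ (k + 2) * F'` with `F ≥ 2p(k + 2)` bounds the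
      -- second term by `1 / (2p)`; the total excess is at most `1 / p`.
      obtain ⟨F, N, hF, hB, hN⟩ := ihm (2 * (p * (k + 2))) (by positivity)
      have hF0 : 0 < F := lt_of_lt_of_le (by positivity) hF
      obtain ⟨F', N', hF', hC, hN'⟩ := ihk (F - 1) 1 one_pos
      rw [Nat.sub_add_cancel hF0] at hC
      refine ⟨F' * F, N' + F' * N, ?_, hC.step hB (Nat.succ_pos m), ?_⟩
      · nlinarith [Nat.mul_le_mul hF' hF]
      · have h1 : p * (k + 2) * N' ≤ p * (k + 2) * ((k + 2) * F') :=
          Nat.mul_le_mul_left _ (by linarith)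
        have h2 := Nat.mul_le_mul_left F' hN
        have h3 := Nat.mul_le_mul_left ((k + 2) * F') hF
        have h4 : F' * F ≤ (k + 2) * (F' * F) := Nat.le_mul_of_pos_left _ (by omega)
        refine le_of_mul_le_mul_left (a := 2 * (k + 2)) ?_ (by omega)
        nlinarith

/-! ### Non-linearity of the alternating patterns -/

/-- The alternating pattern with two rows and four columns. -/
def alternation : Matrix (Fin 2) (Fin 4) (Fin 2) := !![1, 0, 1, 0; 0, 1, 0, 1]

/-- The alternating pattern with two rows and four columns, upside down. -/
def alternation' : Matrix (Fin 2) (Fin 4) (Fin 2) := !![0, 1, 0, 1; 1, 0, 1, 0]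

theorem contains_alternation {a b : ℕ} {M : Matrix (Fin a) (Fin b) (Fin 2)} :
    Contains M alternation ↔ ∃ r r' c₁ c₂ c₃ c₄, r < r' ∧ c₁ < c₂ ∧ c₂ < c₃ ∧ c₃ < c₄ ∧
      M r c₁ = 1 ∧ M r' c₂ = 1 ∧ M r c₃ = 1 ∧ M r' c₄ = 1 := by
  constructor
  · rintro ⟨r, c, hr, hc, h⟩
    exact ⟨r 0, r 1, c 0, c 1, c 2, c 3, hr (by decide), hc (by decide), hc (by decide),
      hc (by decide), h 0 0 rfl, h 1 1 rfl, h 0 2 rfl, h 1 3 rfl⟩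
  · rintro ⟨r, r', c₁, c₂, c₃, c₄, hr, h12, h23, h34, h1, h2, h3, h4⟩
    refine ⟨![r, r'], ![c₁, c₂, c₃, c₄], ?_, ?_, ?_⟩
    · rw [Fin.strictMono_iff_lt_succ]
      intro i; fin_cases i; exact hr
    · rw [Fin.strictMono_iff_lt_succ]
      intro i; fin_cases i
      exacts [h12, h23, h34]
    · intro i j
      fin_cases i <;> fin_cases j <;> simp [alternation, h1, h2, h3, h4]

theorem contains_alternation' {a b : ℕ} {M : Matrix (Fin a) (Fin b) (Fin 2)} :
    Contains M alternation' ↔ ∃ r r' c₁ c₂ c₃ c₄, r' < r ∧ c₁ < c₂ ∧ c₂ < c₃ ∧ c₃ < c₄ ∧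
      M r c₁ = 1 ∧ M r' c₂ = 1 ∧ M r c₃ = 1 ∧ M r' c₄ = 1 := by
  constructor
  · rintro ⟨r, c, hr, hc, h⟩
    exact ⟨r 1, r 0, c 0, c 1, c 2, c 3, hr (by decide), hc (by decide), hc (by decide),
      hc (by decide), h 1 0 rfl, h 0 1 rfl, h 1 2 rfl, h 0 3 rfl⟩
  · rintro ⟨r, r', c₁, c₂, c₃, c₄, hr, h12, h23, h34, h1, h2, h3, h4⟩
    refine ⟨![r', r], ![c₁, c₂, c₃, c₄], ?_, ?_, ?_⟩
    · rw [Fin.strictMono_iff_lt_succ]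
      intro i; fin_cases i; exact hr
    · rw [Fin.strictMono_iff_lt_succ]
      intro i; fin_cases i
      exacts [h12, h23, h34]
    · intro i j
      fin_cases i <;> fin_cases j <;> simp [alternation', h1, h2, h3, h4]

theorem ExistsFanMatrix.le_ex {k m F N : ℕ} (h : ExistsFanMatrix k m F N) (hN : N ≤ F * m) :
    F * m * k ≤ ex (F * m) alternation := by
  classical
  obtain ⟨Φ, R, K, _, _, _, _, _, E, fan, row, h, hF, hK⟩ := h
  have hbij : Function.Bijective fun p : Φ × Fin m => row p.1 p.2 := by
    refine ⟨fun p q hpq => Prod.ext (h.row_inj hpq).1 (h.row_inj hpq).2, fun r => ?_⟩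
    obtain ⟨φ, i, hr⟩ := h.row_surj r
    exact ⟨(φ, i), hr⟩
  have := Finite.of_surjective _ hbij.2
  have := Fintype.ofFinite R
  have := Fintype.ofFinite K
  have hR : Fintype.card R = F * m := by
    rw [← Nat.card_eq_fintype_card, ← Nat.card_eq_of_bijective _ hbij, Nat.card_prod, hF,
      Nat.card_eq_fintype_card, Fintype.card_fin]
  set o : Fin (F * m) ≃o R := Fintype.orderIsoFinOfCardEq R hR
  set S : Finset K := Finset.univ.filter fun c => ∃ r, E r c with hS
  have hSc : S.card ≤ F * m := by
    refine le_trans (le_of_eq ?_) (hK.trans hN)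
    rw [← Set.ncard_coe_finset]
    simp [hS]
  set s : Fin S.card ≃o S := S.orderIsoOfFin rfl
  -- The nonempty columns are packed to the left and padded with empty ones to a square.
  set M : Matrix (Fin (F * m)) (Fin (F * m)) (Fin 2) :=
    fun i j => if ∃ hj : (j : ℕ) < S.card, E (o i) (s ⟨j, hj⟩) then 1 else 0 with hM
  have hM1 : ∀ i j, M i j = 1 ↔ ∃ hj : (j : ℕ) < S.card, E (o i) (s ⟨j, hj⟩) := by
    intro i j
    simp only [hM]
    split_ifs with hij <;> simp [hij]
  have hav : Avoids M alternation := by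
    intro hcon
    obtain ⟨r, r', c₁, c₂, c₃, c₄, hr, h12, h23, h34, h1, h2, h3, h4⟩ :=
      contains_alternation.1 hcon
    obtain ⟨k1, h1⟩ := (hM1 _ _).1 h1
    obtain ⟨k2, h2⟩ := (hM1 _ _).1 h2
    obtain ⟨k3, h3⟩ := (hM1 _ _).1 h3
    obtain ⟨k4, h4⟩ := (hM1 _ _).1 h4
    have hs : ∀ {x y : Fin (F * m)} (hx : (x : ℕ) < S.card) (hy : (y : ℕ) < S.card), x < y →
        ((s ⟨x, hx⟩ : S) : K) < s ⟨y, hy⟩ := fun hx hy hxy => s.strictMono hxy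
    exact h.avoid _ _ _ _ _ _ (o.strictMono hr) (hs k1 k2 h12) (hs k2 k3 h23) (hs k3 k4 h34)
      h1 h2 h3 h4
  refine le_trans ?_ (ones_le_ex hav)
  have hrow : ∀ i : Fin (F * m), k ≤ (Finset.univ.filter fun j => M i j = 1).card := by
    intro i
    refine (h.le_card_row (o i)).trans ?_
    have hset : {c | E (o i) c} = ((Finset.univ.filter fun c => E (o i) c : Finset K) : Set K) := by
      simp
    rw [hset, Set.ncard_coe_finset]
    rw [← Finset.card_image_of_injective _ (Option.some_injective K)]
    refine le_trans (Finset.card_le_card (t := (Finset.univ.filter fun j => M i j = 1).image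
      fun j : Fin (F * m) =>
        if hj : (j : ℕ) < S.card then some (s ⟨j, hj⟩ : K) else none) ?_) Finset.card_image_le
    intro x hx
    simp only [Finset.mem_image, Finset.mem_filter, Finset.mem_univ, true_and] at hx ⊢
    obtain ⟨c, hc, rfl⟩ := hx
    have hcS : c ∈ S := by
      simp only [hS, Finset.mem_filter, Finset.mem_univ, true_and]
      exact ⟨_, hc⟩
    obtain ⟨j, hj⟩ := s.surjective ⟨c, hcS⟩
    refine ⟨⟨j, j.2.trans_le hSc⟩, (hM1 _ _).2 ⟨j.2, ?_⟩, ?_⟩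
    · simp only [Fin.eta, hj]; exact hc
    · simp [hj]
  rw [ones_eq_sum]
  have := Finset.card_nsmul_le_sum Finset.univ
    (fun i : Fin (F * m) => (Finset.univ.filter fun j => M i j = 1).card) k fun i _ => hrow i
  simpa using this

theorem not_isLinear_alternation : ¬ IsLinear alternation := by
  rintro ⟨C, hC⟩
  -- Fan size `C + 2` matches the bound `N ≤ (C + 2) * F`, so the columns fit into the square, while
  -- each row has `C + 1` ones.
  obtain ⟨F, N, hF, h, hN⟩ := exists_existsFanMatrix C (C + 1) 1 one_pos
  have h1 := h.le_ex (by linarith)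
  have h2 := hC (F * (C + 1 + 1))
  have h3 : 0 < F * (C + 1 + 1) := by positivity
  nlinarith

theorem not_isLinear_alternation' : ¬ IsLinear alternation' := by
  rintro ⟨C, hC⟩
  refine not_isLinear_alternation ⟨C, fun n => le_trans (ex_le fun M hM => ?_) (hC n)⟩
  have hav : Avoids (M.submatrix Fin.rev id) alternation' := by
    intro hcon
    obtain ⟨r, r', c₁, c₂, c₃, c₄, hr, h⟩ := contains_alternation'.1 hcon
    exact hM (contains_alternation.2
      ⟨r.rev, r'.rev, c₁, c₂, c₃, c₄, Fin.rev_lt_rev.2 hr, h⟩)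
  refine le_trans (le_of_eq ?_) (ones_le_ex hav)
  refine Finset.card_bij' (fun p _ => (p.1.rev, p.2)) (fun p _ => (p.1.rev, p.2)) ?_ ?_ ?_ ?_
  · intro p hp
    refine Finset.mem_filter.2 ⟨Finset.mem_univ _, ?_⟩
    simpa using (Finset.mem_filter.1 hp).2
  · intro p hp
    exact Finset.mem_filter.2 ⟨Finset.mem_univ _, (Finset.mem_filter.1 hp).2⟩
  · simp
  · simp

/-! ### Patterns with at most one row -/

theorem isLinear_of_row {l : ℕ} (P : Matrix (Fin 1) (Fin l) (Fin 2)) : IsLinear P := by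
  refine ⟨l, fun n => ex_le fun M hM => ?_⟩
  rw [ones_eq_sum]
  refine (Finset.sum_le_card_nsmul _ _ l fun i _ => ?_).trans (by simp [mul_comm])
  by_contra h
  push Not at h
  set f := Finset.orderEmbOfCardLe _ h.le with hf
  refine hM ⟨fun _ => i, f, Subsingleton.strictMono _, f.strictMono, fun _ j _ => ?_⟩
  have := Finset.orderEmbOfCardLe_mem _ h.le j
  simpa using this

theorem isLinear_of_no_rows {l : ℕ} (P : Matrix (Fin 0) (Fin l) (Fin 2)) : IsLinear P := by
  refine ⟨l, fun n => ex_le fun M hM => ?_⟩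
  have hn : n < l := by
    by_contra hn
    push Not at hn
    exact hM ⟨Fin.elim0, Fin.castLE hn, fun i => i.elim0, Fin.strictMono_castLE hn,
      fun i => i.elim0⟩
  exact (ones_le M).trans (Nat.mul_le_mul_right n hn.le)

/-! ### The word of a minimally non-linear pattern -/

/-- Two rows of a minimally non-linear pattern with more than `4k - 4` columns do not alternate. -/
theorem MinimallyNonLinear.no_alternation {k l : ℕ} {P : Matrix (Fin k) (Fin l) (Fin 2)}
    (hP : MinimallyNonLinear P) (hl : 4 * k - 4 < l) {r r' : Fin k} {c₁ c₂ c₃ c₄ : Fin l}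
    (h12 : c₁ < c₂) (h23 : c₂ < c₃) (h34 : c₃ < c₄) (h1 : P r c₁ = 1) (h2 : P r' c₂ = 1)
    (h3 : P r c₃ = 1) (h4 : P r' c₄ = 1) : r = r' := by
  have key : ∀ Q : Matrix (Fin 2) (Fin 4) (Fin 2), ¬ IsLinear Q → ¬ Contains P Q := by
    intro Q hQ hc
    refine hQ (isLinear_iff_isBigO.2 (hP.2 _ _ Q hc ?_))
    intro h
    have e1 : 2 = k := congrArg (fun x => x.1) h
    have e2 : 4 = l := congrArg (fun x => x.2.1) h
    omega
  rcases lt_trichotomy r r' with h | h | h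
  · exact absurd (contains_alternation.2 ⟨r, r', c₁, c₂, c₃, c₄, h, h12, h23, h34, h1, h2, h3, h4⟩)
      (key _ not_isLinear_alternation)
  · exact h
  · exact absurd
      (contains_alternation'.2 ⟨r, r', c₁, c₂, c₃, c₄, h, h12, h23, h34, h1, h2, h3, h4⟩)
      (key _ not_isLinear_alternation')

theorem eraseCol_apply_of_lt {k l : ℕ} {P : Matrix (Fin k) (Fin (l + 1)) (Fin 2)}
    {j : Fin (l + 1)} {a : Fin k} {u : ℕ} (hu : u < j) (hul : u < l) :
    eraseCol P j a ⟨u, hul⟩ = P a ⟨u, by omega⟩ := by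
  simp only [eraseCol, Matrix.submatrix_apply, id]
  rw [Fin.succAbove_of_castSucc_lt _ _ (by simpa [Fin.lt_def] using hu)]
  rfl

theorem eraseCol_apply_of_le {k l : ℕ} {P : Matrix (Fin k) (Fin (l + 1)) (Fin 2)}
    {j : Fin (l + 1)} {a : Fin k} {u : ℕ} (hu : (j : ℕ) ≤ u) (hul : u < l) :
    eraseCol P j a ⟨u, hul⟩ = P a ⟨u + 1, by omega⟩ := by
  simp only [eraseCol, Matrix.submatrix_apply, id]
  rw [Fin.succAbove_of_le_castSucc _ _ (by simpa [Fin.le_def] using hu)]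
  rfl

/-- One can choose a one in each column so that a column repeating the choice of its left
neighbour has a single one, and so that the first two choices agree only if both columns have
a single one. -/
theorem exists_choice {k l : ℕ} {P : Matrix (Fin k) (Fin l) (Fin 2)} (h2 : 1 < l)
    (hne : ∀ j, ∃ i, P i j = 1) :
    ∃ s : ℕ → Fin k, (∀ (j : ℕ) (hj : j < l), P (s j) ⟨j, hj⟩ = 1) ∧
      (∀ (j : ℕ) (hj : j + 1 < l), s (j + 1) = s j → ∀ i, P i ⟨j + 1, hj⟩ = 1 → i = s j) ∧
      (s 1 = s 0 → ∀ i, P i ⟨0, by omega⟩ = 1 → i = s 0) := by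
  have hstep : ∀ (j : ℕ) (x : Fin k), ∃ y : Fin k, (∀ hj : j < l, P y ⟨j, hj⟩ = 1) ∧
      (y = x → ∀ hj : j < l, ∀ i, P i ⟨j, hj⟩ = 1 → i = x) := by
    intro j x
    by_cases hj : j < l
    · by_cases h : ∃ y, P y ⟨j, hj⟩ = 1 ∧ y ≠ x
      · obtain ⟨y, hy, hyx⟩ := h
        exact ⟨y, fun _ => hy, fun h => absurd h hyx⟩
      · push Not at h
        obtain ⟨y, hy⟩ := hne ⟨j, hj⟩
        exact ⟨y, fun _ => hy, fun _ _ => h⟩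
    · exact ⟨x, fun h => absurd h hj, fun _ h => absurd h hj⟩
  choose g hg1 hg2 using hstep
  -- The choice in column `0` avoids `x`, a one of column `1`, when possible. If the first two
  -- choices still agree, column `1` has a single one, so it is `x`, and column `0` had no
  -- alternative to `x`.
  obtain ⟨x, hx⟩ := hne ⟨1, h2⟩
  set s : ℕ → Fin k := fun j => Nat.rec (g 0 x) (fun j y => g (j + 1) y) j with hs
  have hs0 : s 0 = g 0 x := rfl
  have hss : ∀ j, s (j + 1) = g (j + 1) (s j) := fun j => rfl
  refine ⟨s, ?_, ?_, ?_⟩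
  · intro j hj
    cases j with
    | zero => exact hg1 0 x hj
    | succ j => exact hg1 (j + 1) (s j) hj
  · intro j hj h
    exact hg2 (j + 1) (s j) h hj
  · intro h
    have h1 : x = s 0 := hg2 1 (s 0) h h2 x hx
    rw [← h1]
    exact hg2 0 x (hs0.symm.trans h1.symm) (by omega)

theorem MinimallyNonLinear.card_columns_le {k l : ℕ} {P : Matrix (Fin k) (Fin l) (Fin 2)}
    (hP : MinimallyNonLinear P) (hk : 2 ≤ k) : l ≤ 4 * k - 4 := by
  by_contra hl
  push Not at hl
  obtain ⟨l, rfl⟩ : ∃ l', l = l' + 1 := ⟨l - 1, by omega⟩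
  have hne : ∀ j, ∃ i, P i j = 1 := by
    intro j
    by_contra h
    push Not at h
    exact hP.not_isLinear (isLinear_of_empty h (hP.isLinear_eraseCol j))
  obtain ⟨s, hs1, hs2, hs3⟩ := exists_choice (by omega) hne
  refine absurd (length_le_of_no_alternation hk (l + 1) s ?_ ?_ ?_ ?_) (not_le.2 hl)
  · intro a b c d hab hbc hcd hd hac hbd
    refine hP.no_alternation hl (c₁ := ⟨a, by omega⟩) (c₂ := ⟨b, by omega⟩)
      (c₃ := ⟨c, by omega⟩) (c₄ := ⟨d, hd⟩) hab hbc hcd (hs1 _ _) (hs1 _ _) ?_ ?_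
    · rw [hac]; exact hs1 _ _
    · rw [hbd]; exact hs1 _ _
  · intro i hi h1 h2
    refine hP.not_isLinear (isLinear_of_between (j := ⟨i + 1, by omega⟩) (a := s i)
      (u := ⟨i, by omega⟩) (v := ⟨i + 1, by omega⟩) (hs2 i _ h1.symm) rfl rfl ?_ ?_
      (hP.isLinear_eraseCol _))
    · rw [eraseCol_apply_of_lt (Nat.lt_succ_self i)]
      exact hs1 _ _
    -- After the deletion of column `i + 1`, position `i + 1` holds the former column `i + 2`.
    · rw [eraseCol_apply_of_le le_rfl, h1, h2]
      exact hs1 _ _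
  · intro _ h
    refine hP.not_isLinear (isLinear_of_first (a := s 0) (u := ⟨0, by omega⟩) (hs3 h.symm) rfl ?_
      (hP.isLinear_eraseCol _))
    rw [eraseCol_apply_of_le (u := 0) (by simp), h]
    exact hs1 _ _
  · intro i hi h
    have hlast : Fin.last l = ⟨i + 1, by omega⟩ := Fin.ext (by simp; omega)
    refine hP.not_isLinear (isLinear_of_last (a := s i) (u := ⟨i, by omega⟩) ?_ (by simp; omega) ?_
      (hP.isLinear_eraseCol _))
    · rw [hlast]
      exact hs2 i _ h.symm
    · rw [eraseCol_apply_of_lt (by simp; omega)]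
      exact hs1 _ _

end ZeroOneMatrix

theorem mainTheorem2 (k l : ℕ) (P : Matrix (Fin k) (Fin l) (Fin 2))
    (hP : ZeroOneMatrix.MinimallyNonLinear P) :
    (l : ℤ) ≤ 4 * (k : ℤ) - 4 := by
  -- For `k ≤ 1` the integer bound is not positive, so these cases are excluded by linearity.
  match k, P, hP with
  | 0, P, hP => exact absurd (ZeroOneMatrix.isLinear_of_no_rows P) hP.not_isLinear
  | 1, P, hP => exact absurd (ZeroOneMatrix.isLinear_of_row P) hP.not_isLinear
  | k + 2, P, hP =>
    have := hP.card_columns_le (by omega)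
    push_cast
    omega
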